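/- Let $\Gamma$ be an amenable group and let $k$ be a finite abelian group. Write $k\Gamma$ for the group of finite formal sums $\sum_t a_t t$ ($a_t\in k$, $t\in\Gamma$), with its left and right multiplication by elements of the integral group ring $\mathbb Z\Gamma$. For a left $\mathbb Z\Gamma$-module $\mathcal M$ let $\rho(\mathcal M)\in[0,\infty]$ be the topological entropy of the action of $\Gamma$ on the compact Pontryagin dual $\widehat{\mathcal M}=\mathrm{Hom}_{\mathbb Z}(\mathcal M,S^1)$ given by $(s\chi)(m)=\chi(s^{-1}m)$. (1) If $\mathcal M\subseteq k\Gamma$ is a nonzero left $\mathbb Z\Gamma$-submodule, then $\rho(\mathcal M)>0$. (2) Let $f=\sum_t f_t t\in\mathbb Z\Gamma$ be nonzero with support $S=\{t\in\Gamma : f_t\neq 0\}$, and let $k\cdot f=\{af : a\in k\}\subseteq k\Gamma$, where $af=\sum_t (f_t a)\,t$. Then $$\rho(k\Gamma\cdot f)\ \ge\ \frac{\log|k\cdot f|}{|S|^2}.$$ In particular, if no nonzero element of $k$ is annihilated by all coefficients $f_t$ of $f$ (equivalently, if the greatest common divisor of the coefficients of $f$ is coprime to $|k|$), then $$\rho(k\Gamma\cdot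 f)\ \ge\ \frac{\log|k|}{|S|^2}.$$ -/

import Mathlib

open Filter Set
open scoped ENNReal Pointwise

noncomputable section

namespace AlgEntropy

/-! ### Amenability and limits along more and more left invariant finite sets -/

section Amenable

variable (Γ : Type*) [Group Γ]

open scoped Classical in
/-- The nonempty finite sets `F ⊆ Γ` with `|K F \ F| ≤ δ |F|`. -/
def invariantSets (K : Finset Γ) (δ : ℝ) : Set (Finset Γ) :=
  {F | F.Nonempty ∧ (((K * F) \ F).card : ℝ) ≤ δ * (F.card : ℝ)}

/-- The (discrete) group `Γ` is amenable (Følner's condition): for every finite `K` and every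
`δ > 0` there is a `(K, δ)`-invariant nonempty finite set. -/
def IsAmenable : Prop :=
  ∀ (K : Finset Γ) (δ : ℝ), 0 < δ → (invariantSets Γ K δ).Nonempty

/-- The filter on finite subsets `F` of `Γ` that expresses
"`F` becomes more and more left invariant". -/
def invariance : Filter (Finset Γ) :=
  ⨅ (K : Finset Γ) (δ : ℝ) (_ : 0 < δ), 𝓟 (invariantSets Γ K δ)

end Amenable

/-! ### Topological entropy of an action of an amenable group, by open covers -/

section Entropy

variable (Γ : Type*) {X : Type*}

/-- `𝒰` is an open cover of `X`. -/
def IsOpenCover [TopologicalSpace X] (𝒰 : Set (Set X)) : Prop :=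
  (∀ U ∈ 𝒰, IsOpen U) ∧ ⋃₀ 𝒰 = univ

/-- The least cardinality of a finite subfamily of `𝒰` that still covers `X`. -/
def coverNumber (𝒰 : Set (Set X)) : ℕ :=
  sInf {n | ∃ 𝒱 : Finset (Set X), (𝒱 : Set (Set X)) ⊆ 𝒰 ∧ ⋃₀ (𝒱 : Set (Set X)) = univ ∧
    𝒱.card = n}

variable {Γ}

/-- The join `⋁_{s ∈ F} s⁻¹ 𝒰`: the family of all sets `⋂_{s ∈ F} s⁻¹ U_s` with `U_s ∈ 𝒰`. -/
def refinement [SMul Γ X] (𝒰 : Set (Set X)) (F : Finset Γ) : Set (Set X) :=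
  {V | ∃ U : Γ → Set X, (∀ s ∈ F, U s ∈ 𝒰) ∧ V = ⋂ s ∈ F, (fun x : X => s • x) ⁻¹' (U s)}

/-- The entropy of the action relative to `𝒰`: the limit of `log N(⋁_{s ∈ F} s⁻¹ 𝒰) / |F|` as `F`
becomes more and more left invariant. For amenable `Γ` and an open cover of a compact space the
limit exists by the Ornstein-Weiss lemma, so that it agrees with the lower limit used here. -/
def coverEntropy (Γ : Type*) [Group Γ] [SMul Γ X] (𝒰 : Set (Set X)) : ℝ≥0∞ :=
  liminf (fun F : Finset Γ =>
    ENNReal.ofReal (Real.log (coverNumber (refinement 𝒰 F)) / (F.card : ℝ))) (invariance Γ)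

/-- The topological entropy of an action of an amenable group `Γ` on a compact space `X`. -/
def topEntropy (Γ X : Type*) [Group Γ] [TopologicalSpace X] [SMul Γ X] : ℝ≥0∞ :=
  ⨆ (𝒰 : Set (Set X)) (_ : IsOpenCover 𝒰), coverEntropy Γ 𝒰

end Entropy

/-! ### The algebraic action attached to a left `ℤΓ`-module, and its torsion -/

section Dual

/-- The abelian group `M`, written multiplicatively and equipped with the discrete topology. -/
def DiscreteMul (M : Type*) : Type _ := Multiplicative M

instance (M : Type*) [AddCommGroup M] : CommGroup (DiscreteMul M) :=
  inferInstanceAs (CommGroup (Multiplicative M))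

instance (M : Type*) : TopologicalSpace (DiscreteMul M) := ⊥

instance (M : Type*) : DiscreteTopology (DiscreteMul M) := ⟨rfl⟩

/-- The Pontryagin dual of the discrete abelian group `M`: all homomorphisms from `M` to the
circle, with the compact-open topology, that is, the topology of pointwise convergence. -/
abbrev Dual (M : Type*) [AddCommGroup M] : Type _ := PontryaginDual (DiscreteMul M)

namespace Dual

variable {M : Type*} [AddCommGroup M]

/-- The value of a character at an element of `M`. -/
def eval (χ : Dual M) (m : M) : Circle := χ (show DiscreteMul M from Multiplicative.ofAdd m)

theorem ext {χ ψ : Dual M} (h : ∀ m, χ.eval m = ψ.eval m) : χ = ψ :=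
  PontryaginDual.ext fun a => h (Multiplicative.toAdd (show Multiplicative M from a))

/-- An endomorphism of `M`, in multiplicative notation. -/
def toDiscreteMul (φ : M →+ M) : DiscreteMul M →ₜ* DiscreteMul M where
  toMonoidHom := (AddMonoidHom.toMultiplicative φ : Multiplicative M →* Multiplicative M)
  continuous_toFun := continuous_of_discreteTopology

/-- Precomposition of characters with an endomorphism of `M`. -/
def precomp (φ : M →+ M) (χ : Dual M) : Dual M := PontryaginDual.map (toDiscreteMul φ) χ

theorem eval_precomp (φ : M →+ M) (χ : Dual M) (m : M) :
    (precomp φ χ).eval m = χ.eval (φ m) := rfl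

theorem continuous_precomp (φ : M →+ M) : Continuous (precomp φ) :=
  (PontryaginDual.map (toDiscreteMul φ)).continuous_toFun

variable {Γ : Type*} [Group Γ] [Module (MonoidAlgebra ℤ Γ) M]

/-- The dual action of `Γ` on the dual of a left `ℤΓ`-module: `(s χ)(m) = χ(s⁻¹ m)`. -/
instance : SMul Γ (Dual M) where
  smul s χ := precomp (DistribSMul.toAddMonoidHom M (MonoidAlgebra.of ℤ Γ s⁻¹)) χ

theorem eval_smul (s : Γ) (χ : Dual M) (m : M) :
    (s • χ).eval m = χ.eval (MonoidAlgebra.of ℤ Γ s⁻¹ • m) := rfl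

instance : MulAction Γ (Dual M) where
  one_smul χ := ext fun m => by rw [eval_smul, inv_one, map_one, one_smul]
  mul_smul s t χ := ext fun m => by
    rw [eval_smul, eval_smul, eval_smul, mul_inv_rev, map_mul, mul_smul]

instance : ContinuousConstSMul Γ (Dual M) where
  continuous_const_smul _ := continuous_precomp _

end Dual

/-- The torsion `ρ(M)` of a left `ℤΓ`-module `M`: the entropy of the action of `Γ` on the
Pontryagin dual of `M`. -/
def torsion (Γ M : Type*) [Group Γ] [AddCommGroup M] [Module (MonoidAlgebra ℤ Γ) M] : ℝ≥0∞ :=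
  topEntropy Γ (Dual M)

end Dual

/-! ### The `ℤΓ`-bimodule `kΓ` for an abelian group `k` -/

section Coefficients

/-- `kΓ`: finite formal sums `∑ a_t t` with `t ∈ Γ` and `a_t` in the abelian group `k`. -/
def GroupModule (k Γ : Type*) [AddCommGroup k] : Type _ := Γ →₀ k

namespace GroupModule

variable {k Γ : Type*} [AddCommGroup k]

instance : AddCommGroup (GroupModule k Γ) := inferInstanceAs (AddCommGroup (Γ →₀ k))

/-- The element `a t` of `kΓ`. -/
def single (t : Γ) (a : k) : GroupModule k Γ := Finsupp.single t a

theorem single_zero (t : Γ) : single t (0 : k) = 0 := Finsupp.single_zero t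

theorem single_add (t : Γ) (a b : k) : single t (a + b) = single t a + single t b :=
  Finsupp.single_add t a b

theorem addHom_ext {A : Type*} [AddCommGroup A] {φ ψ : GroupModule k Γ →+ A}
    (h : ∀ t a, φ (single t a) = ψ (single t a)) : φ = ψ :=
  Finsupp.addHom_ext (M := k) (α := Γ) h

variable [Group Γ]

/-- Left translation of `kΓ` by elements of `Γ`. -/
def leftTranslation : Representation ℤ Γ (GroupModule k Γ) where
  toFun s := Finsupp.lmapDomain k ℤ (fun t => s * t)
  map_one' := by
    refine LinearMap.ext fun x => ?_
    simp only [one_mul]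
    exact Finsupp.mapDomain_id
  map_mul' s t := by
    refine LinearMap.ext fun x => ?_
    simp only [mul_assoc]
    exact Finsupp.mapDomain_comp (f := fun u => t * u) (g := fun u => s * u)

/-- The left `ℤΓ`-module structure of `kΓ`, with `(n s) (a t) = (n a) (s t)`. -/
instance : Module (MonoidAlgebra ℤ Γ) (GroupModule k Γ) :=
  Module.compHom (GroupModule k Γ) (leftTranslation (k := k) (Γ := Γ)).asAlgebraHom.toRingHom

theorem single_smul_single (s t : Γ) (n : ℤ) (a : k) :
    (MonoidAlgebra.single s n : MonoidAlgebra ℤ Γ) • single t a = single (s * t) (n • a) := by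
  change (leftTranslation (k := k)).asAlgebraHom (MonoidAlgebra.single s n) (single t a) = _
  rw [Representation.asAlgebraHom_single]
  change n • Finsupp.mapDomain (fun u => s * u) (Finsupp.single t a) = Finsupp.single (s * t) (n • a)
  rw [Finsupp.mapDomain_single, Finsupp.smul_single]

/-- The product `x f` of `x ∈ kΓ` and `f ∈ ℤΓ`, with `(a s) (n t) = (n a) (s t)`. -/
def mulRightFun (f : MonoidAlgebra ℤ Γ) : GroupModule k Γ →+ GroupModule k Γ :=
  Finsupp.liftAddHom fun s : Γ =>
    { toFun := fun a => f.coeff.sum fun t n => single (s * t) (n • a)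
      map_zero' := by simp only [smul_zero, single_zero, Finsupp.sum, Finset.sum_const_zero]
      map_add' := fun a b => by
        simp only [smul_add, single_add, Finsupp.sum, Finset.sum_add_distrib] }

theorem mulRightFun_single (f : MonoidAlgebra ℤ Γ) (s : Γ) (a : k) :
    mulRightFun f (single s a) = f.coeff.sum fun t n => single (s * t) (n • a) :=
  Finsupp.liftAddHom_apply_single _ _ _

theorem mulRightFun_single_smul_single (f : MonoidAlgebra ℤ Γ) (s t : Γ) (n : ℤ) (a : k) :
    mulRightFun f ((MonoidAlgebra.single s n : MonoidAlgebra ℤ Γ) • single t a) =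
      (MonoidAlgebra.single s n : MonoidAlgebra ℤ Γ) • mulRightFun f (single t a) := by
  rw [single_smul_single, mulRightFun_single, mulRightFun_single]
  refine Eq.trans ?_ (map_finsuppSum (DistribSMul.toAddMonoidHom (GroupModule k Γ)
    (MonoidAlgebra.single s n : MonoidAlgebra ℤ Γ)) f.coeff
      fun u m => single (t * u) (m • a)).symm
  refine Finset.sum_congr rfl fun u _ => ?_
  change single (s * t * u) (f.coeff u • n • a) =
    (MonoidAlgebra.single s n : MonoidAlgebra ℤ Γ) • single (t * u) (f.coeff u • a)
  rw [single_smul_single, mul_assoc, smul_comm]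

/-- Right multiplication by `f ∈ ℤΓ`, a homomorphism of left `ℤΓ`-modules `kΓ → kΓ`. -/
def mulRight (f : MonoidAlgebra ℤ Γ) :
    GroupModule k Γ →ₗ[MonoidAlgebra ℤ Γ] GroupModule k Γ where
  toFun := mulRightFun f
  map_add' := map_add _
  map_smul' r x := by
    change mulRightFun f (r • x) = r • mulRightFun f x
    induction r using MonoidAlgebra.induction_linear with
    | zero => simp only [zero_smul, map_zero]
    | add p q hp hq => simp only [add_smul, map_add, hp, hq]
    | single s n =>
      let L := DistribSMul.toAddMonoidHom (GroupModule k Γ)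
        (MonoidAlgebra.single s n : MonoidAlgebra ℤ Γ)
      have h : (mulRightFun f).comp L = L.comp (mulRightFun f) :=
        addHom_ext fun t a => mulRightFun_single_smul_single f s t n a
      exact DFunLike.congr_fun h x

theorem mulRight_single (f : MonoidAlgebra ℤ Γ) (s : Γ) (a : k) :
    mulRight f (single s a) = f.coeff.sum fun t n => single (s * t) (n • a) :=
  mulRightFun_single f s a

end GroupModule

end Coefficients

end AlgEntropy

end

/-!
All three assertions come from one estimate. Let `M ⊆ kΓ` be a submodule and let `A ⊆ M` be a finite
subgroup whose elements are supported in a nonempty finite set `S ⊆ Γ`. Then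
`torsion Γ M ≥ log |A| / |S| ^ 2` (`GroupModule.ofReal_log_card_div_le_torsion`). Multiples of a
nonzero `x ∈ M` give positivity, and `A = k · f` gives the bounds for `kΓ f`.

For the estimate, cover the dual of `M` by the open sets of characters with a given restriction to
`A`. Two characters in one member of the refined cover for `F` agree on all `s⁻¹ A` with `s ∈ F`.
A maximal `T ⊆ F` for which the translates `t⁻¹ S` are disjoint has at least `|F| / |S| ^ 2`
elements (`exists_disjoint_translates`), and disjointness of supports makes the sum of the `t⁻¹ A`
with `t ∈ T` direct (`GroupModule.sumTranslates_injective`). The characters of `M` separate the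
points of this finite group of order `|A| ^ |T|`, so by finite duality they restrict to at least
`|A| ^ |T|` different characters of it (`card_le_card_range_of_separating`). Hence the cover number
is at least `|A| ^ |T|` for every nonempty finite `F`, and the lower limit defining the entropy
inherits the bound.
-/

open Filter Set
open scoped ENNReal Pointwise

noncomputable section

namespace AlgEntropy

/-! ### Entropy bounds from cover numbers -/

section Entropy

variable {Γ X : Type*}

/-- A map that is constant on the members of a cover with a finite subcover takes at most as many
values as the cover number. The finite subcover matters: without one `coverNumber` is `0`. -/
theorem card_range_le_coverNumber {Y : Type*} {𝒰 : Set (Set X)}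
    (hfin : ∃ 𝒱 : Finset (Set X), (𝒱 : Set (Set X)) ⊆ 𝒰 ∧ ⋃₀ (𝒱 : Set (Set X)) = univ)
    (R : X → Y) (hR : ∀ V ∈ 𝒰, ∀ x ∈ V, ∀ y ∈ V, R x = R y) :
    Nat.card (range R) ≤ coverNumber 𝒰 := by
  obtain ⟨𝒲, h𝒲, hcov⟩ := hfin
  refine le_csInf ⟨_, 𝒲, h𝒲, hcov, rfl⟩ ?_
  rintro _ ⟨𝒱, h𝒱, hcover, rfl⟩
  have hmem : ∀ y : range R, ∃ V : 𝒱, ∃ x ∈ (V : Set X), R x = y := by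
    rintro ⟨_, x, rfl⟩
    obtain ⟨V, hV, hx⟩ := mem_sUnion.1 (hcover ▸ mem_univ x : x ∈ ⋃₀ (𝒱 : Set (Set X)))
    exact ⟨⟨V, hV⟩, x, hx, rfl⟩
  choose V x hx hxR using hmem
  have hinj : Function.Injective V := fun y z h => Subtype.ext <| by
    rw [← hxR y, ← hxR z]
    exact hR _ (h𝒱 (V z).2) _ (h ▸ hx y) _ (hx z)
  simpa using Nat.card_le_card_of_injective V hinj

theorem exists_finite_subcover_of_isOpenCover [TopologicalSpace X] [CompactSpace X]
    {𝒰 : Set (Set X)} (h𝒰 : IsOpenCover 𝒰) :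
    ∃ 𝒱 : Finset (Set X), (𝒱 : Set (Set X)) ⊆ 𝒰 ∧ ⋃₀ (𝒱 : Set (Set X)) = univ := by
  classical
  obtain ⟨t, ht⟩ := isCompact_univ.elim_finite_subcover (fun U : 𝒰 => (U : Set X))
    (fun U => h𝒰.1 U U.2) (by rw [← sUnion_eq_iUnion, h𝒰.2])
  refine ⟨t.image Subtype.val, by simp, univ_subset_iff.1 fun x hx => ?_⟩
  obtain ⟨U, hU, hxU⟩ := mem_iUnion₂.1 (ht hx)
  exact ⟨U, by simpa using hU, hxU⟩

theorem isOpenCover_refinement [TopologicalSpace X] [SMul Γ X] [ContinuousConstSMul Γ X]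
    {𝒰 : Set (Set X)} (h𝒰 : IsOpenCover 𝒰) (F : Finset Γ) : IsOpenCover (refinement 𝒰 F) := by
  constructor
  · rintro _ ⟨U, hU, rfl⟩
    exact isOpen_biInter_finset fun s hs => (h𝒰.1 _ (hU s hs)).preimage (continuous_const_smul s)
  · refine univ_subset_iff.1 fun x _ => ?_
    have hx : ∀ s : Γ, ∃ U ∈ 𝒰, s • x ∈ U := fun s =>
      mem_sUnion.1 (h𝒰.2 ▸ mem_univ (s • x) : s • x ∈ ⋃₀ 𝒰)
    choose U hU hxU using hx
    exact ⟨_, ⟨U, fun s _ => hU s, rfl⟩, mem_iInter₂.2 fun s _ => hxU s⟩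

theorem eventually_nonempty_invariance (Γ : Type*) [Group Γ] :
    ∀ᶠ F : Finset Γ in invariance Γ, F.Nonempty :=
  mem_of_superset (mem_iInf_of_mem ∅ (mem_iInf_of_mem 1 (mem_iInf_of_mem one_pos
    (mem_principal_self _)))) fun _ hF => hF.1

/-- A lower bound that holds for each nonempty finite subset of `Γ`, invariant or not, passes to
the entropy. -/
theorem le_topEntropy [Group Γ] [TopologicalSpace X] [SMul Γ X] {𝒰 : Set (Set X)}
    (h𝒰 : IsOpenCover 𝒰) {c : ℝ}
    (hc : ∀ F : Finset Γ, F.Nonempty →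
      c ≤ Real.log (coverNumber (refinement 𝒰 F)) / (F.card : ℝ)) :
    ENNReal.ofReal c ≤ topEntropy Γ X :=
  le_iSup₂_of_le 𝒰 h𝒰 <| le_liminf_of_le (by isBoundedDefault) <|
    (eventually_nonempty_invariance Γ).mono fun F hF => ENNReal.ofReal_le_ofReal (hc F hF)

end Entropy

/-! ### Characters -/

/-- A group of characters of a finite abelian group `G` that separates the points of `G` has at
least `|G|` elements: `G` embeds into the dual of that group of characters. -/
theorem card_le_card_range_of_separating {G H : Type*} [CommGroup G] [Finite G] [Group H]
    (R : H →* (G →* Circleˣ)) (hsep : ∀ g : G, (∀ h, R h g = 1) → g = 1) :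
    Nat.card G ≤ Nat.card (range R) := by
  have hfin : ∀ (K : Type _) [CommGroup K] [Finite K], Finite (K →* Circleˣ) := fun K _ _ =>
    Nat.finite_of_card_ne_zero <| by
      rw [CommGroup.card_monoidHom_of_hasEnoughRootsOfUnity]
      exact Nat.card_pos.ne'
  have := hfin G
  have := hfin R.range
  let ev : G → (R.range →* Circleˣ) := fun g => (MonoidHom.eval g).comp R.range.subtype
  have hinj : Function.Injective ev := fun g g' h => by
    refine div_eq_one.1 (hsep _ fun x => ?_)
    rw [map_div, div_eq_one]
    exact DFunLike.congr_fun h (⟨R x, x, rfl⟩ : R.range)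
  refine (Nat.card_le_card_of_injective ev hinj).trans_eq ?_
  rw [CommGroup.card_monoidHom_of_hasEnoughRootsOfUnity]
  rfl

theorem finite_setOf_circle_pow_eq_one {n : ℕ} (hn : 0 < n) : {z : Circle | z ^ n = 1}.Finite := by
  refine ((Polynomial.nthRootsFinset n (1 : ℂ)).finite_toSet.preimage
    Circle.coe_injective.injOn).subset fun z hz => ?_
  rw [mem_preimage, Finset.mem_coe, Polynomial.mem_nthRootsFinset hn]
  exact (Circle.coe_pow z n).symm.trans (congrArg _ hz)

namespace Dual

variable {M : Type*} [AddCommGroup M]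

/-- A character as an additive homomorphism. -/
def evalAddHom (χ : Dual M) : M →+ Additive Circle where
  toFun m := Additive.ofMul (χ.eval m)
  map_zero' := congrArg Additive.ofMul (map_one χ)
  map_add' m n := congrArg Additive.ofMul
    (map_mul χ (show DiscreteMul M from Multiplicative.ofAdd m)
      (show DiscreteMul M from Multiplicative.ofAdd n))

/-- Every homomorphism from `M` to the circle is continuous for the discrete topology. -/
def ofAddHom (φ : M →+ Additive Circle) : Dual M where
  toMonoidHom := (AddMonoidHom.toMultiplicative φ : Multiplicative M →* Circle)
  continuous_toFun := continuous_of_discreteTopology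

/-- Characters of `M`, pulled back along `P : G → M` to characters of `G`. Their values are taken in
`Circleˣ`, the form in which Mathlib states duality for finite abelian groups. -/
def pullback {G : Type*} [AddCommGroup G] (P : G →+ M) :
    Dual M →* (Multiplicative G →* Circleˣ) where
  toFun χ :=
    { toFun := fun g => toUnits (χ.eval (P g.toAdd))
      map_one' := (congrArg (fun z : Additive Circle => toUnits z.toMul)
        (map_zero (χ.evalAddHom.comp P))).trans (map_one toUnits)
      map_mul' := fun g h => (congrArg (fun z : Additive Circle => toUnits z.toMul)
        (map_add (χ.evalAddHom.comp P) g.toAdd h.toAdd)).trans (map_mul toUnits _ _) }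
  map_one' := MonoidHom.ext fun _ => map_one toUnits
  map_mul' _ _ := MonoidHom.ext fun _ => map_mul toUnits _ _

theorem pullback_apply {G : Type*} [AddCommGroup G] (P : G →+ M) (χ : Dual M) (g : G) :
    pullback P χ (Multiplicative.ofAdd g) = toUnits (χ.eval (P g)) := rfl

theorem continuous_eval (m : M) : Continuous fun χ : Dual M => χ.eval m :=
  (continuous_eval_const (F := C(DiscreteMul M, Circle))
    (show DiscreteMul M from Multiplicative.ofAdd m)).comp
    (f := fun χ : DiscreteMul M →ₜ* Circle => (χ : C(DiscreteMul M, Circle)))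
    (ContinuousMonoidHom.isInducing_toContinuousMap (DiscreteMul M) Circle).continuous

/-- At an element of finite order, characters take values in the finite set of roots of unity of
that order, so that they are locally constant there. -/
theorem isOpen_setOf_eval_eq {m : M} (hm : IsOfFinAddOrder m) (z : Circle) :
    IsOpen {χ : Dual M | χ.eval m = z} := by
  have hpow : ∀ χ : Dual M, χ.eval m ^ addOrderOf m = 1 := fun χ => by
    have h := map_nsmul χ.evalAddHom (addOrderOf m) m
    rw [addOrderOf_nsmul_eq_zero, map_zero] at h
    exact (congrArg Additive.toMul h).symm
  have hfin : ({w : Circle | w ^ addOrderOf m = 1} \ {z}).Finite :=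
    (finite_setOf_circle_pow_eq_one hm.addOrderOf_pos).sdiff
  convert hfin.isClosed.isOpen_compl.preimage (continuous_eval m) using 1
  ext χ
  simp [hpow χ]

/-- The family of the sets of characters with prescribed restriction to `A`. -/
def restrictionCover (A : AddSubgroup M) : Set (Set (Dual M)) :=
  range fun χ₀ : Dual M => {χ : Dual M | ∀ a ∈ A, χ.eval a = χ₀.eval a}

theorem isOpenCover_restrictionCover (A : AddSubgroup M) [Finite A] :
    IsOpenCover (restrictionCover A) := by
  constructor
  · rintro _ ⟨χ₀, rfl⟩
    have : {χ : Dual M | ∀ a ∈ A, χ.eval a = χ₀.eval a} =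
        ⋂ a : A, {χ : Dual M | χ.eval (a : M) = χ₀.eval a} := by
      ext; simp
    change IsOpen {χ : Dual M | ∀ a ∈ A, χ.eval a = χ₀.eval a}
    rw [this]
    exact isOpen_iInter_of_finite fun a => isOpen_setOf_eval_eq
      (A.subtype.isOfFinAddOrder (isOfFinAddOrder_of_finite a)) _
  · exact univ_subset_iff.1 fun χ _ => ⟨_, ⟨χ, rfl⟩, fun _ _ => rfl⟩

/-- The translates `t⁻¹ A` for `t ∈ T`, collected into one homomorphism `∏_{t ∈ T} A → M`. -/
def sumTranslates {Γ : Type*} [Group Γ] [Module (MonoidAlgebra ℤ Γ) M] (A : AddSubgroup M)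
    (T : Finset Γ) : (T → A) →+ M where
  toFun a := ∑ t : T, MonoidAlgebra.of ℤ Γ (t : Γ)⁻¹ • (a t : M)
  map_zero' := by simp
  map_add' a b := by simp [smul_add, Finset.sum_add_distrib]

/-- Characters of `M` in one member of the refined cover agree on `s⁻¹ A` for `s ∈ F`, and so on
the sum of these translates. If the sum over `T ⊆ F` is direct and the characters separate the
points of `M`, there are `|A| ^ |T|` characters of this sum to tell apart. -/
theorem card_pow_le_coverNumber {Γ : Type*} [Group Γ] [Module (MonoidAlgebra ℤ Γ) M]
    (hM : ∀ m : M, (∀ χ : Dual M, χ.eval m = 1) → m = 0)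
    (A : AddSubgroup M) [Finite A] {T F : Finset Γ} (hTF : T ⊆ F)
    (hinj : Function.Injective (sumTranslates A T)) :
    Nat.card A ^ T.card ≤ coverNumber (refinement (restrictionCover A) F) := by
  have hcard : Nat.card (Multiplicative (T → A)) = Nat.card A ^ T.card := by
    change Nat.card (T → A) = _
    rw [Nat.card_fun, Nat.card_eq_fintype_card (α := T), Fintype.card_coe]
  have : Finite (Multiplicative (T → A)) := inferInstanceAs (Finite (T → A))
  rw [← hcard]
  refine (card_le_card_range_of_separating (pullback (sumTranslates A T)) ?_).trans
    (card_range_le_coverNumber (exists_finite_subcover_of_isOpenCover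
      (isOpenCover_refinement (isOpenCover_restrictionCover A) F)) _ ?_)
  · intro g hg
    have h0 : sumTranslates A T g.toAdd = 0 := hM _ fun χ => by
      have := hg χ
      rwa [← ofAdd_toAdd g, pullback_apply, map_eq_one_iff _ toUnits.injective] at this
    exact Multiplicative.toAdd.injective (hinj (h0.trans (map_zero _).symm))
  · rintro _ ⟨U, hU, rfl⟩ χ hχ ψ hψ
    have key : ∀ s ∈ F, ∀ a ∈ A,
        χ.evalAddHom (MonoidAlgebra.of ℤ Γ s⁻¹ • a) =
          ψ.evalAddHom (MonoidAlgebra.of ℤ Γ s⁻¹ • a) := by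
      intro s hs a ha
      obtain ⟨χ₀, h₀⟩ := hU s hs
      have h1 : s • χ ∈ U s := mem_iInter₂.1 hχ s hs
      have h2 : s • ψ ∈ U s := mem_iInter₂.1 hψ s hs
      rw [← h₀] at h1 h2
      exact congrArg Additive.ofMul ((h1 a ha).trans (h2 a ha).symm)
    have hsum : ∀ a : T → A, χ.evalAddHom (sumTranslates A T a) =
        ψ.evalAddHom (sumTranslates A T a) := fun a => by
      change χ.evalAddHom (∑ t : T, _) = ψ.evalAddHom (∑ t : T, _)
      rw [map_sum, map_sum]
      exact Finset.sum_congr rfl fun t _ => key t (hTF t.2) _ (a t).2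
    exact MonoidHom.ext fun g => congrArg (fun z : Additive Circle => toUnits z.toMul)
      (hsum g.toAdd)

end Dual

/-! ### Packing disjoint translates -/

/-- A maximal family of disjoint translates `t⁻¹ S` with `t ∈ F`: every other `u ∈ F` then lies in
`S S⁻¹ t` for some `t` in the family. -/
theorem exists_disjoint_translates {Γ : Type*} [Group Γ] {S : Finset Γ} (hS : S.Nonempty)
    (F : Finset Γ) :
    ∃ T ⊆ F, F.card ≤ T.card * S.card ^ 2 ∧
      ∀ t ∈ T, ∀ u ∈ T, ∀ x ∈ S, ∀ y ∈ S, t⁻¹ * x = u⁻¹ * y → t = u := by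
  classical
  let P : Finset Γ → Prop := fun T =>
    ∀ t ∈ T, ∀ u ∈ T, ∀ x ∈ S, ∀ y ∈ S, t⁻¹ * x = u⁻¹ * y → t = u
  obtain ⟨T, hT⟩ := (F.powerset.filter P).exists_maximal ⟨∅, by simp [P]⟩
  have hTF : T ⊆ F := by simpa using (Finset.mem_filter.1 hT.1).1
  have hTP : P T := (Finset.mem_filter.1 hT.1).2
  refine ⟨T, hTF, ?_, hTP⟩
  have hcover : F ⊆ (T ×ˢ (S ×ˢ S)).image fun p => p.2.2 * p.2.1⁻¹ * p.1 := by
    intro u hu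
    rw [Finset.mem_image]
    by_contra! hno
    have hne : ∀ t ∈ T, ∀ x ∈ S, ∀ y ∈ S, t⁻¹ * x ≠ u⁻¹ * y := by
      intro t ht x hx y hy h
      refine hno (t, x, y) (by simp [ht, hx, hy]) ?_
      have : y = u * (t⁻¹ * x) := by rw [h, mul_inv_cancel_left]
      simp [this, mul_assoc]
    have hP : P (insert u T) := by
      intro t ht v hv x hx y hy h
      rcases Finset.mem_insert.1 ht with rfl | ht' <;>
        rcases Finset.mem_insert.1 hv with rfl | hv'
      · rfl
      · exact (hne v hv' y hy x hx h.symm).elim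
      · exact (hne t ht' x hx y hy h).elim
      · exact hTP t ht' v hv' x hx y hy h
    have huT : u ∈ T := hT.2 (Finset.mem_filter.2 ⟨Finset.mem_powerset.2
      (Finset.insert_subset hu hTF), hP⟩) (Finset.subset_insert u T) (Finset.mem_insert_self u T)
    obtain ⟨x, hx⟩ := hS
    exact hne u huT x hx x hx rfl
  calc F.card ≤ _ := Finset.card_le_card hcover
    _ ≤ _ := Finset.card_image_le
    _ = T.card * S.card ^ 2 := by rw [Finset.card_product, Finset.card_product, sq]

/-! ### Submodules of `kΓ` -/

namespace GroupModule

variable {k Γ : Type*} [AddCommGroup k]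

/-- The coefficient of an element of `kΓ` at `t`. -/
def coeff (t : Γ) : GroupModule k Γ →+ k := Finsupp.applyAddHom t

theorem ext_coeff {x y : GroupModule k Γ} (h : ∀ t, coeff t x = coeff t y) : x = y :=
  Finsupp.ext h

theorem coeff_single_self (t : Γ) (a : k) : coeff t (single t a) = a := Finsupp.single_eq_same

theorem coeff_single_of_ne {s t : Γ} (h : s ≠ t) (a : k) : coeff t (single s a) = 0 :=
  Finsupp.single_eq_of_ne h.symm

theorem exists_finset_forall_coeff_eq_zero (x : GroupModule k Γ) :
    ∃ S : Finset Γ, ∀ t ∉ S, coeff t x = 0 :=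
  ⟨Finsupp.support x, fun _ ht => Finsupp.notMem_support_iff.1 ht⟩

theorem coeff_of_smul [Group Γ] (s t : Γ) (x : GroupModule k Γ) :
    coeff t (MonoidAlgebra.of ℤ Γ s • x) = coeff (s⁻¹ * t) x := by
  have h : (coeff t).comp (DistribSMul.toAddMonoidHom (GroupModule k Γ) (MonoidAlgebra.of ℤ Γ s)) =
      coeff (s⁻¹ * t) := by
    refine addHom_ext fun u a => ?_
    change coeff t (MonoidAlgebra.single s (1 : ℤ) • single u a) = _
    rw [single_smul_single, one_smul]
    by_cases hu : s * u = t
    · rw [← hu, inv_mul_cancel_left, coeff_single_self, coeff_single_self]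
    · rw [coeff_single_of_ne hu, coeff_single_of_ne (by rwa [Ne, eq_inv_mul_iff_mul_eq])]
  exact DFunLike.congr_fun h x

/-- The characters of `M ⊆ kΓ` separate points: a nonzero element is detected by a character of `k`
at one of its coefficients. -/
theorem eq_zero_of_forall_eval_eq_one [Group Γ] [Finite k]
    {M : Submodule (MonoidAlgebra ℤ Γ) (GroupModule k Γ)} (m : M)
    (hm : ∀ χ : Dual M, χ.eval m = 1) : m = 0 := by
  refine Subtype.ext (ext_coeff fun t => ?_)
  refine AddChar.forall_apply_eq_zero.1 fun ψ => ?_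
  have h := hm (Dual.ofAddHom ((AddChar.circleEquivComplex.symm ψ).toAddMonoidHom.comp
    ((coeff t).comp M.subtype.toAddMonoidHom)))
  rw [← AddChar.circleEquivComplex.apply_symm_apply ψ]
  exact congrArg ((↑) : Circle → ℂ) h

/-- In `M ⊆ kΓ`, translates of `A` by elements that make their supports disjoint are
independent. -/
theorem sumTranslates_injective [Group Γ] {M : Submodule (MonoidAlgebra ℤ Γ) (GroupModule k Γ)}
    (A : AddSubgroup M) {S T : Finset Γ} (hA : ∀ a ∈ A, ∀ t ∉ S, coeff t (a : GroupModule k Γ) = 0)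
    (hT : ∀ t ∈ T, ∀ u ∈ T, ∀ x ∈ S, ∀ y ∈ S, t⁻¹ * x = u⁻¹ * y → t = u) :
    Function.Injective (Dual.sumTranslates A T) := by
  classical
  -- At `t⁻¹ x` with `x ∈ S` only the summand with index `t` contributes.
  have hcoeff : ∀ (a : T → A) (t : T), ∀ x ∈ S,
      coeff ((t : Γ)⁻¹ * x) (Dual.sumTranslates A T a : GroupModule k Γ) =
        coeff x ((a t : M) : GroupModule k Γ) := by
    intro a t x hx
    have hsum : (Dual.sumTranslates A T a : GroupModule k Γ) =
        ∑ u : T, MonoidAlgebra.of ℤ Γ (u : Γ)⁻¹ • ((a u : M) : GroupModule k Γ) :=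
      map_sum M.subtype _ _
    rw [hsum, map_sum, Finset.sum_eq_single t]
    · rw [coeff_of_smul, inv_inv, mul_inv_cancel_left]
    · intro u _ hut
      rw [coeff_of_smul, inv_inv]
      refine hA _ (a u).2 _ fun hy => hut ?_
      exact (Subtype.ext (hT t t.2 u u.2 x hx _ hy (inv_mul_cancel_left _ _).symm)).symm
    · simp
  refine (injective_iff_map_eq_zero _).2 fun a ha => ?_
  refine funext fun t => Subtype.ext (Subtype.ext (ext_coeff fun x => ?_))
  by_cases hx : x ∈ S
  · rw [← hcoeff a t x hx, ha]
    rfl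
  · exact hA _ (a t).2 x hx

/-- The entropy bound: by packing, `|A| ^ |T| ≤ N` with `|F| ≤ |T| |S| ^ 2` for every nonempty
finite `F`. -/
theorem ofReal_log_card_div_le_torsion [Group Γ] [Finite k]
    {M : Submodule (MonoidAlgebra ℤ Γ) (GroupModule k Γ)} (A : AddSubgroup M) [Finite A]
    {S : Finset Γ} (hS : S.Nonempty)
    (hA : ∀ a ∈ A, ∀ t ∉ S, coeff t (a : GroupModule k Γ) = 0) :
    ENNReal.ofReal (Real.log (Nat.card A) / (S.card : ℝ) ^ 2) ≤ torsion Γ M := by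
  refine le_topEntropy (Dual.isOpenCover_restrictionCover A) fun F hF => ?_
  obtain ⟨T, hTF, hcard, hT⟩ := exists_disjoint_translates hS F
  have hN := Dual.card_pow_le_coverNumber eq_zero_of_forall_eval_eq_one A hTF
    (sumTranslates_injective A hA hT)
  have hA0 : 0 < Nat.card A := Nat.card_pos
  have hlog : 0 ≤ Real.log (Nat.card A) := Real.log_natCast_nonneg _
  have hlogN : T.card * Real.log (Nat.card A) ≤
      Real.log (coverNumber (refinement (Dual.restrictionCover A) F)) := by
    rw [← Real.log_pow]
    exact Real.log_le_log (by positivity) (by exact_mod_cast hN)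
  have hcard' : (F.card : ℝ) ≤ T.card * (S.card : ℝ) ^ 2 := by exact_mod_cast hcard
  have hS0 : (0 : ℝ) < S.card := by exact_mod_cast hS.card_pos
  have hF0 : (0 : ℝ) < F.card := by exact_mod_cast hF.card_pos
  rw [div_le_div_iff₀ (by positivity) hF0]
  calc Real.log (Nat.card A) * F.card ≤ Real.log (Nat.card A) * (T.card * (S.card : ℝ) ^ 2) := by
        gcongr
    _ = T.card * Real.log (Nat.card A) * (S.card : ℝ) ^ 2 := by ring
    _ ≤ _ := by gcongr

/-- The bound applied to the multiples of a nonzero element of `M`. -/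
theorem torsion_pos [Group Γ] [Finite k]
    {M : Submodule (MonoidAlgebra ℤ Γ) (GroupModule k Γ)} (hM : M ≠ ⊥) : 0 < torsion Γ M := by
  obtain ⟨x, hxM, hx⟩ := M.exists_mem_ne_zero_of_ne_bot hM
  obtain ⟨S, hS⟩ := exists_finset_forall_coeff_eq_zero x
  have hSne : S.Nonempty := by
    by_contra h
    rw [Finset.not_nonempty_iff_eq_empty] at h
    exact hx (ext_coeff fun t => by rw [hS t (by simp [h]), map_zero])
  let m : M := ⟨x, hxM⟩
  have hfin : Finite (AddSubgroup.zmultiples m) := by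
    refine (finite_zmultiples.2 <| isOfFinAddOrder_iff_nsmul_eq_zero.2 ?_).to_subtype
    refine ⟨Nat.card k, Nat.card_pos, Subtype.ext (ext_coeff fun t => ?_)⟩
    change coeff t (Nat.card k • x) = 0
    rw [map_nsmul, card_nsmul_eq_zero']
  have hbound := ofReal_log_card_div_le_torsion (AddSubgroup.zmultiples m) hSne <| by
    rintro _ ⟨n, rfl⟩ t ht
    change coeff t (n • x) = 0
    rw [map_zsmul, hS t ht, smul_zero]
  refine lt_of_lt_of_le (ENNReal.ofReal_pos.2 (div_pos (Real.log_pos ?_) ?_)) hbound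
  · have : Nontrivial (AddSubgroup.zmultiples m) := (AddSubgroup.nontrivial_iff_ne_bot _).2 <| by
      rw [Ne, AddSubgroup.zmultiples_eq_bot]
      exact fun h => hx (congrArg Subtype.val h)
    exact_mod_cast Finite.one_lt_card
  · have := hSne.card_pos
    positivity

variable [Group Γ]

theorem coeff_mulRight_single_one (f : MonoidAlgebra ℤ Γ) (a : k) (t : Γ) :
    coeff t (mulRight f (single 1 a)) = f.coeff t • a := by
  classical
  rw [mulRight_single, Finsupp.sum, map_sum]
  simp only [one_mul]
  rw [Finset.sum_eq_single t, coeff_single_self]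
  · exact fun u _ hu => coeff_single_of_ne hu _
  · intro ht
    rw [Finsupp.notMem_support_iff.1 ht, zero_smul, single_zero, map_zero]

/-- The homomorphism `a ↦ a f` from `k` to `kΓ f`. -/
def coeffMul (f : MonoidAlgebra ℤ Γ) : k →+ LinearMap.range (mulRight (k := k) f) where
  toFun a := ⟨mulRight f (single 1 a), _, rfl⟩
  map_zero' := Subtype.ext (by simp [single_zero])
  map_add' a b := Subtype.ext (by simp [single_add])

/-- The bound applied to the subgroup `k · f` of `kΓ f`, which is supported in the support of `f`. -/
theorem ofReal_log_card_range_div_le_torsion [Finite k] {f : MonoidAlgebra ℤ Γ} (hf : f ≠ 0) :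
    ENNReal.ofReal (Real.log (Nat.card (range fun a : k => mulRight f (single (1 : Γ) a))) /
        (f.coeff.support.card : ℝ) ^ 2) ≤
      torsion Γ (LinearMap.range (mulRight (k := k) f)) := by
  have hS : f.coeff.support.Nonempty :=
    Finsupp.support_nonempty_iff.2 fun h => hf (by ext t; simp [h])
  have : Finite (coeffMul (k := k) f).range := inferInstanceAs (Finite (range (coeffMul f)))
  have hbound := ofReal_log_card_div_le_torsion (coeffMul (k := k) f).range hS <| by
    rintro _ ⟨a, rfl⟩ t ht
    change coeff t (mulRight f (single 1 a)) = 0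
    rw [coeff_mulRight_single_one, Finsupp.notMem_support_iff.1 ht, zero_smul]
  have hcard : Nat.card (range fun a : k => mulRight f (single (1 : Γ) a)) =
      Nat.card (coeffMul (k := k) f).range := by
    have himage : (range fun a : k => mulRight f (single (1 : Γ) a)) =
        Subtype.val '' (range (coeffMul (k := k) f)) := by
      rw [← range_comp]
      rfl
    rw [himage, Nat.card_image_of_injective Subtype.val_injective]
    rfl
  rwa [hcard]

theorem injective_mulRight_single_one {f : MonoidAlgebra ℤ Γ}
    (hf : ∀ a : k, (∀ t : Γ, f.coeff t • a = 0) → a = 0) :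
    Function.Injective fun a : k => mulRight f (single (1 : Γ) a) := by
  intro a b hab
  refine sub_eq_zero.1 (hf _ fun t => ?_)
  rw [smul_sub, ← coeff_mulRight_single_one, ← coeff_mulRight_single_one]
  exact sub_eq_zero.2 (congrArg (coeff t) hab)

end GroupModule

end AlgEntropy

theorem lemma4p1 {Γ k : Type*} [Group Γ] [AddCommGroup k] [Finite k]
    (hΓ : AlgEntropy.IsAmenable Γ) :
    (∀ M : Submodule (MonoidAlgebra ℤ Γ) (AlgEntropy.GroupModule k Γ),
      M ≠ ⊥ → 0 < AlgEntropy.torsion Γ M) ∧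
    (∀ f : MonoidAlgebra ℤ Γ, f ≠ 0 →
      ENNReal.ofReal
          (Real.log (Nat.card (range fun a : k =>
              AlgEntropy.GroupModule.mulRight f (AlgEntropy.GroupModule.single (1 : Γ) a))) /
            (f.coeff.support.card : ℝ) ^ 2) ≤
        AlgEntropy.torsion Γ
          (LinearMap.range (AlgEntropy.GroupModule.mulRight (k := k) f))) ∧
    (∀ f : MonoidAlgebra ℤ Γ, f ≠ 0 →
      (∀ a : k, (∀ t : Γ, f.coeff t • a = 0) → a = 0) →
      ENNReal.ofReal (Real.log (Nat.card k) / (f.coeff.support.card : ℝ) ^ 2) ≤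
        AlgEntropy.torsion Γ
          (LinearMap.range (AlgEntropy.GroupModule.mulRight (k := k) f))) := by
  refine ⟨fun M hM => AlgEntropy.GroupModule.torsion_pos hM, fun f hf =>
    AlgEntropy.GroupModule.ofReal_log_card_range_div_le_torsion hf, fun f hf hk => ?_⟩
  rw [← Nat.card_range_of_injective (AlgEntropy.GroupModule.injective_mulRight_single_one hk)]
  exact AlgEntropy.GroupModule.ofReal_log_card_range_div_le_torsion hf
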